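/- Let $G$ be a finite simple undirected graph on $n$ vertices that contains no $K_5$ (no five pairwise adjacent vertices), and let $\tau_B(G)$ denote the minimum size of a set of edges of $G$ whose deletion makes $G$ bipartite. Then $$\tau_B(G) \le \frac{29\,n^2}{200}.$$ -/

import Mathlib

/-- The minimum size of a set of edges of the finite graph `G` whose deletion makes `G` bipartite.
The minimum is over a nonempty set and is attained, see `tauB_attained`. -/
noncomputable def tauB {V : Type*} [Finite V] (G : SimpleGraph V) : ℕ :=
  sInf {k : ℕ | ∃ S : Finset (Sym2 V),
    (S : Set (Sym2 V)) ⊆ G.edgeSet ∧ (G.deleteEdges (S : Set (Sym2 V))).IsBipartite ∧ S.card = k}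

/-- Some edge set of size `tauB G` makes `G` bipartite when it is deleted. -/
theorem tauB_attained {V : Type*} [Finite V] (G : SimpleGraph V) :
    ∃ S : Finset (Sym2 V), (S : Set (Sym2 V)) ⊆ G.edgeSet ∧
      (G.deleteEdges (S : Set (Sym2 V))).IsBipartite ∧ S.card = tauB G := by
  refine Nat.sInf_mem (s := {k : ℕ | ∃ S : Finset (Sym2 V), (S : Set (Sym2 V)) ⊆ G.edgeSet ∧
    (G.deleteEdges (S : Set (Sym2 V))).IsBipartite ∧ S.card = k}) ?_
  refine ⟨_, (Set.toFinite G.edgeSet).toFinset, by simp, ?_, rfl⟩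
  refine ⟨SimpleGraph.Coloring.mk (fun _ => 0) ?_⟩
  intro v w h
  simp [SimpleGraph.deleteEdges_adj] at h

namespace SimpleGraph

variable {V : Type*}

/-! `adjPairs` counts ordered pairs, so it suffices to find a 2-colouring with at most 29/100 n²
monochromatic pairs. Let E be the number of adjacent pairs. If E ≤ 63/100 n², each vertex v gives
two colourings: the cut N(v) against the rest, and a good colouring of N(v) extended greedily.
`exists_coloring_of_nbrsIn` averages these over v. As N(v) contains no K₄, the bounds build up from
K₃ through K₄ to K₅. If E ≥ 63/100 n², `exists_coloring_of_turan_deficit` gives a 4-colouring with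
few monochromatic edges, and merging its colours in pairs gives a good cut. -/

open Classical in
/-- The number of ordered pairs in `A × B` that are adjacent in `G`, as a real number. -/
noncomputable def adjPairs (G : SimpleGraph V) (A B : Finset V) : ℝ :=
  ∑ u ∈ A, ∑ v ∈ B, if G.Adj u v then 1 else 0

/-- The subgraph of the edges of `G` whose two ends have the same colour. -/
def monoGraph {κ : Type*} (G : SimpleGraph V) (f : V → κ) : SimpleGraph V where
  Adj u v := G.Adj u v ∧ f u = f v
  symm := ⟨fun _ _ h => ⟨h.1.symm, h.2.symm⟩⟩
  loopless := ⟨fun _ h => G.loopless.irrefl _ h.1⟩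

open Classical in
/-- The neighbours of `v` in `W`. -/
noncomputable def nbrsIn (G : SimpleGraph V) (W : Finset V) (v : V) : Finset V :=
  W.filter fun u => G.Adj v u

theorem mem_nbrsIn {G : SimpleGraph V} {W : Finset V} {u v : V} :
    u ∈ G.nbrsIn W v ↔ u ∈ W ∧ G.Adj v u := by
  simp [nbrsIn]

theorem nbrsIn_subset (G : SimpleGraph V) (W : Finset V) (v : V) : G.nbrsIn W v ⊆ W :=
  fun _ hu => (mem_nbrsIn.1 hu).1

theorem adjPairs_nonneg (G : SimpleGraph V) (A B : Finset V) : 0 ≤ G.adjPairs A B :=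
  Finset.sum_nonneg fun _ _ => Finset.sum_nonneg fun _ _ => by split_ifs <;> norm_num

theorem adjPairs_comm (G : SimpleGraph V) (A B : Finset V) :
    G.adjPairs A B = G.adjPairs B A := by
  classical
  unfold adjPairs
  rw [Finset.sum_comm]
  exact Finset.sum_congr rfl fun u _ => Finset.sum_congr rfl fun v _ =>
    if_congr (G.adj_comm v u) rfl rfl

theorem adjPairs_eq_sum_card (G : SimpleGraph V) (A B : Finset V) :
    G.adjPairs A B = ∑ u ∈ A, ((G.nbrsIn B u).card : ℝ) := by
  simp [adjPairs, nbrsIn]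

theorem adjPairs_congr {G H : SimpleGraph V} {A B : Finset V}
    (h : ∀ u ∈ A, ∀ v ∈ B, (G.Adj u v ↔ H.Adj u v)) : G.adjPairs A B = H.adjPairs A B := by
  classical
  unfold adjPairs
  refine Finset.sum_congr rfl fun u hu => Finset.sum_congr rfl fun v hv => ?_
  exact if_congr (h u hu v hv) rfl rfl

theorem adjPairs_eq_zero {G : SimpleGraph V} {A B : Finset V}
    (h : ∀ u ∈ A, ∀ v ∈ B, ¬ G.Adj u v) : G.adjPairs A B = 0 := by
  unfold adjPairs
  exact Finset.sum_eq_zero fun u hu => Finset.sum_eq_zero fun v hv => by simp [h u hu v hv]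

variable [DecidableEq V]

theorem adjPairs_union_left (G : SimpleGraph V) {A B : Finset V} (h : Disjoint A B)
    (C : Finset V) : G.adjPairs (A ∪ B) C = G.adjPairs A C + G.adjPairs B C := by
  unfold adjPairs
  exact Finset.sum_union h

theorem adjPairs_union (G : SimpleGraph V) {A B : Finset V} (h : Disjoint A B) :
    G.adjPairs (A ∪ B) (A ∪ B) =
      G.adjPairs A A + 2 * G.adjPairs A B + G.adjPairs B B := by
  rw [adjPairs_union_left G h, adjPairs_comm G A, adjPairs_comm G B,
    adjPairs_union_left G h, adjPairs_union_left G h, adjPairs_comm G B A]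
  ring

/-! ### Two colourings from one neighbourhood, and their average -/

/-- Greedy: each new vertex takes the colour rarer among its earlier neighbours, so at most half of
the added edges become monochromatic. -/
theorem exists_extend_coloring (G : SimpleGraph V) (f : V → Bool) (N A : Finset V)
    (h : Disjoint N A) : ∃ g : V → Bool,
      (G.monoGraph g).adjPairs (N ∪ A) (N ∪ A) ≤ (G.monoGraph f).adjPairs N N +
        (G.adjPairs (N ∪ A) (N ∪ A) - G.adjPairs N N) / 2 := by
  induction A using Finset.induction_on with
  | empty => exact ⟨f, by simp⟩
  | insert w A hw ih =>
    rw [Finset.disjoint_insert_right] at h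
    obtain ⟨g, hg⟩ := ih h.2
    set U := N ∪ A with hU
    have hwU : w ∉ U := by simp [hU, h.1, hw]
    have hdis : Disjoint U {w} := by simpa using hwU
    have e : N ∪ insert w A = U ∪ {w} := by
      rw [Finset.union_insert, Finset.insert_eq, Finset.union_comm]
    have key : ∀ b : Bool,
        (G.monoGraph (Function.update g w b)).adjPairs (U ∪ {w}) (U ∪ {w}) =
          (G.monoGraph g).adjPairs U U +
            2 * (G.monoGraph (Function.update g w b)).adjPairs U {w} := by
      intro b
      have hne : ∀ u ∈ U, u ≠ w := fun u hu => by rintro rfl; exact hwU hu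
      rw [adjPairs_union _ hdis,
        adjPairs_congr (G := G.monoGraph (Function.update g w b)) (H := G.monoGraph g)
          (A := U) (B := U)
          fun u hu v hv => by simp [monoGraph, hne u hu, hne v hv],
        adjPairs_eq_zero (A := {w}) (B := {w}) fun u hu v hv => by
          rw [Finset.mem_singleton] at hu hv; subst hu; subst hv; exact SimpleGraph.irrefl _]
      ring
    have hsum : (G.monoGraph (Function.update g w true)).adjPairs U {w} +
        (G.monoGraph (Function.update g w false)).adjPairs U {w} = G.adjPairs U {w} := by
      unfold adjPairs
      rw [← Finset.sum_add_distrib]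
      refine Finset.sum_congr rfl fun u hu => ?_
      have hne : u ≠ w := by rintro rfl; exact hwU hu
      by_cases ha : G.Adj u w <;> cases hgu : g u <;> simp [monoGraph, hne, ha, hgu, -Finset.sum_boole]
    have hE := adjPairs_union G hdis
    have h0 : G.adjPairs {w} {w} = 0 := adjPairs_eq_zero fun u hu v hv => by
      rw [Finset.mem_singleton] at hu hv; subst hu; subst hv; exact SimpleGraph.irrefl _
    rw [e]
    rcases le_total ((G.monoGraph (Function.update g w true)).adjPairs U {w})
      ((G.monoGraph (Function.update g w false)).adjPairs U {w}) with hle | hle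
    · exact ⟨_, by rw [key true]; linarith⟩
    · exact ⟨_, by rw [key false]; linarith⟩

theorem exists_cut_nbrsIn (G : SimpleGraph V) (W : Finset V) (v : V) : ∃ g : V → Bool,
    (G.monoGraph g).adjPairs W W = G.adjPairs W W -
      2 * G.adjPairs (G.nbrsIn W v) W + 2 * G.adjPairs (G.nbrsIn W v) (G.nbrsIn W v) := by
  set N := G.nbrsIn W v with hN
  have hNW : N ∪ (W \ N) = W := Finset.union_sdiff_of_subset (nbrsIn_subset G W v)
  have hdis : Disjoint N (W \ N) := Finset.disjoint_sdiff
  refine ⟨fun u => decide (u ∈ N), ?_⟩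
  have h1 := adjPairs_union (G.monoGraph fun u => decide (u ∈ N)) hdis
  have h2 := adjPairs_union G hdis
  have h3 := adjPairs_union_left G hdis N
  rw [hNW] at h1 h2 h3
  rw [h1, adjPairs_congr (H := G) (A := N) (B := N), adjPairs_eq_zero (A := N) (B := W \ N),
    adjPairs_congr (H := G) (A := W \ N) (B := W \ N), adjPairs_comm G N W, h3, h2,
    adjPairs_comm G (W \ N) N]
  · ring
  · intro u hu w hw
    rw [Finset.mem_sdiff] at hu hw
    simp [monoGraph, hu.2, hw.2]
  · intro u hu w hw
    rw [Finset.mem_sdiff] at hw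
    simp [monoGraph, hu, hw.2]
  · intro u hu w hw
    simp [monoGraph, hu, hw]

omit [DecidableEq V] in
-- Double counting: the degree of u is summed once for each neighbour v of u.
theorem sum_adjPairs_nbrsIn (G : SimpleGraph V) (W : Finset V) :
    ∑ v ∈ W, G.adjPairs (G.nbrsIn W v) W = ∑ v ∈ W, ((G.nbrsIn W v).card : ℝ) ^ 2 := by
  simp only [adjPairs_eq_sum_card]
  rw [Finset.sum_comm' (t' := W) (s' := fun u => G.nbrsIn W u)]
  · simp only [Finset.sum_const, nsmul_eq_mul, sq]
  · intro v u
    simp only [mem_nbrsIn, G.adj_comm u v]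
    tauto

/-- Bounds for the cuts of all neighbourhoods combine to a bound for the whole graph. -/
theorem exists_coloring_of_nbrsIn (G : SimpleGraph V) (W : Finset V) (α β l s : ℝ)
    (hl0 : 0 ≤ l) (hl1 : l ≤ 1) (hγ : 0 ≤ 2 * (1 - l) - l * α)
    (hT : ∀ v ∈ W, (l * (β - 1 / 2) + 2 * (1 - l)) *
      G.adjPairs (G.nbrsIn W v) (G.nbrsIn W v) ≤ 0)
    (h : ∀ v ∈ W, ∃ f : V → Bool,
      (G.monoGraph f).adjPairs (G.nbrsIn W v) (G.nbrsIn W v) ≤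
        α * ((G.nbrsIn W v).card : ℝ) ^ 2 +
          β * G.adjPairs (G.nbrsIn W v) (G.nbrsIn W v)) :
    ∃ f : V → Bool, (G.monoGraph f).adjPairs W W ≤
      (2 * (1 - l) - l * α) * s ^ 2 * (W.card : ℝ) ^ 2 +
        (1 - l / 2 - 2 * s * (2 * (1 - l) - l * α)) * G.adjPairs W W := by
  rcases W.eq_empty_or_nonempty with rfl | hW
  · exact ⟨fun _ => true, by simp [adjPairs]⟩
  by_contra! hcon
  obtain ⟨γ, hγdef⟩ : ∃ γ, γ = 2 * (1 - l) - l * α := ⟨_, rfl⟩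
  rw [← hγdef] at hγ hcon
  obtain ⟨t, ht⟩ : ∃ t, t = γ * s ^ 2 * (W.card : ℝ) ^ 2 + (1 - l / 2 - 2 * s * γ) * G.adjPairs W W := ⟨_, rfl⟩
  rw [← ht] at hcon
  obtain ⟨E, hE⟩ : ∃ E, E = G.adjPairs W W := ⟨_, rfl⟩
  rw [← hE] at ht
  -- The extended colouring gets weight l and the cut 1 - l; by `hT` the edges inside the
  -- neighbourhood can then be dropped.
  have pt : ∀ v ∈ W, t < (1 - l / 2) * E + l * α * ((G.nbrsIn W v).card : ℝ) ^ 2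
      - 2 * (1 - l) * G.adjPairs (G.nbrsIn W v) W := by
    intro v hv
    obtain ⟨f, hf⟩ := h v hv
    obtain ⟨g, hg⟩ := exists_extend_coloring G f (G.nbrsIn W v) (W \ G.nbrsIn W v)
      Finset.disjoint_sdiff
    rw [Finset.union_sdiff_of_subset (nbrsIn_subset G W v), ← hE] at hg
    obtain ⟨k, hk⟩ := exists_cut_nbrsIn G W v
    have h1 := hcon g
    have h2 := hcon k
    have h3 := hT v hv
    rw [hk, ← hE] at h2
    have h4 : t < α * ((G.nbrsIn W v).card : ℝ) ^ 2 +
          β * G.adjPairs (G.nbrsIn W v) (G.nbrsIn W v) +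
          (E - G.adjPairs (G.nbrsIn W v) (G.nbrsIn W v)) / 2 := by linarith
    rcases hl0.eq_or_lt with rfl | hl0
    · linarith
    · have h5 := mul_lt_mul_of_pos_left h4 hl0
      have h6 := mul_le_mul_of_nonneg_left h2.le (sub_nonneg.2 hl1)
      linarith
  have hs := Finset.sum_lt_sum_of_nonempty hW pt
  rw [Finset.sum_sub_distrib, Finset.sum_add_distrib, ← Finset.mul_sum, ← Finset.mul_sum,
    ← Finset.mul_sum,
    sum_adjPairs_nbrsIn, Finset.sum_const, Finset.sum_const, nsmul_eq_mul, nsmul_eq_mul] at hs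
  -- Tangent line to d² at d = s|W|, summed over the degrees.
  have hq : 2 * (s * W.card) * E - (s * W.card) ^ 2 * W.card ≤
      ∑ v ∈ W, ((G.nbrsIn W v).card : ℝ) ^ 2 := by
    rw [hE, adjPairs_eq_sum_card, Finset.mul_sum, mul_comm ((s * W.card) ^ 2) _, ← nsmul_eq_mul,
      ← Finset.sum_const, ← Finset.sum_sub_distrib]
    refine Finset.sum_le_sum fun v _ => ?_
    nlinarith [sq_nonneg (((G.nbrsIn W v).card : ℝ) - s * W.card)]
  have h7 := mul_le_mul_of_nonneg_left hq hγ
  have h8 : (W.card : ℝ) * t = (W.card : ℝ) * ((1 - l / 2) * E) -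
      γ * (2 * (s * W.card) * E - (s * W.card) ^ 2 * W.card) := by rw [ht]; ring
  have h9 : γ * ∑ v ∈ W, ((G.nbrsIn W v).card : ℝ) ^ 2 =
      2 * (1 - l) * ∑ v ∈ W, ((G.nbrsIn W v).card : ℝ) ^ 2 -
      l * α * ∑ v ∈ W, ((G.nbrsIn W v).card : ℝ) ^ 2 := by rw [hγdef]; ring
  linarith

/-! ### Sparse case: from K₃ to K₅ -/

omit [DecidableEq V] in
theorem CliqueFreeOn.nbrsIn {G : SimpleGraph V} {W : Finset V} {r : ℕ}
    (h : G.CliqueFreeOn W (r + 1)) {v : V} (hv : v ∈ W) :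
    G.CliqueFreeOn (G.nbrsIn W v : Set V) r := by
  refine CliqueFreeOn.subset G (fun u hu => ?_) (CliqueFreeOn.of_succ G h hv)
  simpa [mem_nbrsIn] using hu

omit [DecidableEq V] in
theorem CliqueFreeOn.adjPairs_eq_zero {G : SimpleGraph V} {W : Finset V}
    (h : G.CliqueFreeOn W 2) : G.adjPairs W W = 0 :=
  SimpleGraph.adjPairs_eq_zero fun _ hu _ hv huv =>
    (cliqueFreeOn_two G).1 h hu hv huv.ne huv

theorem exists_coloring_of_cliqueFreeOn_three {G : SimpleGraph V} {W : Finset V}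
    (h : G.CliqueFreeOn W 3) : ∃ f : V → Bool, (G.monoGraph f).adjPairs W W ≤
      529 / 1250 * (W.card : ℝ) ^ 2 - 21 / 25 * G.adjPairs W W := by
  have h0 : ∀ v ∈ W, G.adjPairs (G.nbrsIn W v) (G.nbrsIn W v) = 0 :=
    fun v hv => (h.nbrsIn hv).adjPairs_eq_zero
  -- Neighbourhoods are independent, so the cuts alone suffice: l = 0.
  obtain ⟨f, hf⟩ := exists_coloring_of_nbrsIn G W 0 0 0 (23 / 50) le_rfl zero_le_one
    (by norm_num) (fun v hv => by rw [h0 v hv, mul_zero])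
    (fun v hv => ⟨fun _ => true, by
      rw [adjPairs_congr (H := G) fun u _ w _ => by simp [monoGraph], h0 v hv]; simp⟩)
  exact ⟨f, by linarith⟩

theorem exists_coloring_of_cliqueFreeOn_four {G : SimpleGraph V} {W : Finset V}
    (h : G.CliqueFreeOn W 4) : ∃ f : V → Bool, (G.monoGraph f).adjPairs W W ≤
      71 / 400 * (W.card : ℝ) ^ 2 + 31 / 400 * G.adjPairs W W := by
  obtain ⟨f, hf⟩ := exists_coloring_of_nbrsIn G W (529 / 1250) (-(21 / 25)) (3 / 5) (57 / 100)
    (by norm_num) (by norm_num) (by norm_num)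
    (fun v _ => by
      have := adjPairs_nonneg G (G.nbrsIn W v) (G.nbrsIn W v)
      linarith)
    (fun v hv => by
      obtain ⟨f, hf⟩ := exists_coloring_of_cliqueFreeOn_three (h.nbrsIn hv)
      exact ⟨f, by linarith⟩)
  have := adjPairs_nonneg G W W
  have := sq_nonneg (W.card : ℝ)
  exact ⟨f, by linarith⟩

theorem exists_coloring_of_cliqueFreeOn_five {G : SimpleGraph V} {W : Finset V}
    (h : G.CliqueFreeOn W 5) (hE : G.adjPairs W W ≤ 63 / 100 * (W.card : ℝ) ^ 2) :
    ∃ f : V → Bool, (G.monoGraph f).adjPairs W W ≤ 29 / 100 * (W.card : ℝ) ^ 2 := by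
  -- The weight 413/500 makes the coefficient in `hT` barely negative; the tangent point 63/100 is
  -- the threshold density of `hE`, the worst case since E has a positive coefficient.
  obtain ⟨f, hf⟩ := exists_coloring_of_nbrsIn G W (71 / 400) (31 / 400) (413 / 500) (63 / 100)
    (by norm_num) (by norm_num) (by norm_num)
    (fun v _ => by
      have := adjPairs_nonneg G (G.nbrsIn W v) (G.nbrsIn W v)
      linarith)
    (fun v hv => exists_coloring_of_cliqueFreeOn_four (h.nbrsIn hv))
  have := adjPairs_nonneg G W W
  have := sq_nonneg (W.card : ℝ)
  exact ⟨f, by linarith⟩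

/-! ### Dense case: stability -/

/-- Füredi's stability theorem: a graph without `(r + 2)`-cliques has an `(r + 1)`-colouring
with at most as many monochromatic edges as it falls short of the Turán bound. -/
theorem exists_coloring_of_turan_deficit {G : SimpleGraph V} (r : ℕ) : ∀ {W : Finset V},
    G.CliqueFreeOn W (r + 2) → ∃ c : V → ℕ, (∀ u ∈ W, c u < r + 1) ∧
      G.adjPairs W W + (G.monoGraph c).adjPairs W W ≤
        r / (r + 1) * (W.card : ℝ) ^ 2 := by
  induction r with
  | zero =>
    intro W h
    have h0 : G.adjPairs W W = 0 := CliqueFreeOn.adjPairs_eq_zero h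
    refine ⟨fun _ => 0, by simp, ?_⟩
    rw [adjPairs_congr (G := G.monoGraph _) (H := G) fun u _ w _ => by simp [monoGraph], h0]
    simp
  | succ r ih =>
    intro W h
    rcases W.eq_empty_or_nonempty with rfl | hW
    · exact ⟨fun _ => 0, by simp, by simp [adjPairs]⟩
    obtain ⟨v, hv, hmax⟩ := W.exists_max_image (fun u => (G.nbrsIn W u).card) hW
    obtain ⟨c, hc, hle⟩ := ih (h.nbrsIn hv)
    set N := G.nbrsIn W v with hN
    have hNsub : N ⊆ W := nbrsIn_subset G W v
    have hNW : N ∪ (W \ N) = W := Finset.union_sdiff_of_subset hNsub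
    have hdis : Disjoint N (W \ N) := Finset.disjoint_sdiff
    have hcard : (N.card : ℝ) + ((W \ N).card : ℝ) = W.card := by
      rw [← Nat.cast_add, ← Finset.card_union_of_disjoint hdis, hNW]
    set c' : V → ℕ := fun u => if u ∈ N then c u else r + 1 with hc'
    refine ⟨c', fun u hu => ?_, ?_⟩
    · by_cases huN : u ∈ N
      · simp only [hc', huN, if_true]; exact (hc u huN).trans (Nat.lt_succ_self _)
      · simp [hc', huN]
    have h1 := adjPairs_union (G.monoGraph c') hdis
    have h2 := adjPairs_union G hdis
    have h3 := adjPairs_union_left G hdis (W \ N)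
    rw [hNW] at h1 h2 h3
    have e1 : (G.monoGraph c').adjPairs N N = (G.monoGraph c).adjPairs N N :=
      adjPairs_congr fun u hu w hw => by simp [monoGraph, hc', hu, hw]
    have e2 : (G.monoGraph c').adjPairs N (W \ N) = 0 :=
      SimpleGraph.adjPairs_eq_zero fun u hu w hw => by
        rw [Finset.mem_sdiff] at hw
        have := (hc u hu).ne
        simp [monoGraph, hc', hu, hw.2, this]
    have e3 : (G.monoGraph c').adjPairs (W \ N) (W \ N) = G.adjPairs (W \ N) (W \ N) :=
      adjPairs_congr fun u hu w hw => by
        rw [Finset.mem_sdiff] at hu hw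
        simp [monoGraph, hc', hu.2, hw.2]
    -- Pairs inside `W \ N` count both as adjacent and as monochromatic, so `W \ N` contributes
    -- twice its degree sum; |N| is the maximum degree.
    have h4 : G.adjPairs W (W \ N) ≤ (W \ N).card * N.card := by
      rw [adjPairs_comm, adjPairs_eq_sum_card, ← nsmul_eq_mul]
      exact Finset.sum_le_card_nsmul _ _ _ fun u hu => by
        exact_mod_cast hmax u (Finset.mem_sdiff.1 hu).1
    have h5 : (r : ℝ) / (r + 1) * (N.card : ℝ) ^ 2 + 2 * ((W \ N).card * N.card) ≤
        ((r + 1 : ℕ) : ℝ) / ((r + 1 : ℕ) + 1) * (W.card : ℝ) ^ 2 := by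
      rw [← hcard]
      push_cast
      have hr : (0 : ℝ) ≤ r := Nat.cast_nonneg r
      rw [← sub_nonneg]
      have : ((r : ℝ) + 1) / (r + 1 + 1) * ((N.card : ℝ) + (W \ N).card) ^ 2 -
          (r / (r + 1) * (N.card : ℝ) ^ 2 + 2 * ((W \ N).card * N.card)) =
          ((N.card : ℝ) - (r + 1) * (W \ N).card) ^ 2 / ((r + 1) * (r + 2)) := by
        field_simp
        ring
      rw [this]
      positivity
    rw [h1, e1, e2, e3]
    linarith

theorem exists_coloring_of_cliqueFreeOn_five_of_dense {G : SimpleGraph V} {W : Finset V}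
    (h : G.CliqueFreeOn W 5) (hE : 63 / 100 * (W.card : ℝ) ^ 2 ≤ G.adjPairs W W) :
    ∃ f : V → Bool, (G.monoGraph f).adjPairs W W ≤ 29 / 100 * (W.card : ℝ) ^ 2 := by
  obtain ⟨c, hc, hle⟩ := exists_coloring_of_turan_deficit 3 h
  -- Of the three pairings of four colours, exactly one merges two given distinct colours; an edge
  -- within one class stays monochromatic in all three.
  have hsum : (G.monoGraph fun u => decide (c u < 2)).adjPairs W W +
      (G.monoGraph fun u => decide (c u % 2 = 0)).adjPairs W W +
      (G.monoGraph fun u => decide (c u = 0 ∨ c u = 3)).adjPairs W W =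
      G.adjPairs W W + 2 * (G.monoGraph c).adjPairs W W := by
    unfold adjPairs
    simp only [Finset.mul_sum, ← Finset.sum_add_distrib]
    refine Finset.sum_congr rfl fun u hu => Finset.sum_congr rfl fun v hv => ?_
    have hu := hc u hu
    have hv := hc v hv
    by_cases ha : G.Adj u v
    · simp only [monoGraph, ha, true_and]
      generalize c u = a at *
      generalize c v = b at *
      interval_cases a <;> interval_cases b <;> norm_num
    · simp [monoGraph, ha]
  norm_num at hle
  by_contra! hcon
  have h1 := hcon fun u => decide (c u < 2)
  have h2 := hcon fun u => decide (c u % 2 = 0)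
  have h3 := hcon fun u => decide (c u = 0 ∨ c u = 3)
  linarith

/-! ### From colourings to deleted edges -/

omit [DecidableEq V] in
theorem two_mul_tauB_le [Fintype V] (G : SimpleGraph V) (f : V → Bool) :
    2 * (tauB G : ℝ) ≤ (G.monoGraph f).adjPairs Finset.univ Finset.univ := by
  classical
  have hle : tauB G ≤ (G.monoGraph f).edgeFinset.card := by
    refine Nat.sInf_le ⟨(G.monoGraph f).edgeFinset, ?_, ?_, rfl⟩
    · rw [coe_edgeFinset]
      exact edgeSet_mono fun u v h => h.1
    · rw [coe_edgeFinset]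
      refine ⟨Coloring.mk (fun v => if f v then 0 else 1) ?_⟩
      intro u v huv
      rw [deleteEdges_adj, mem_edgeSet] at huv
      have hne : f u ≠ f v := fun he => huv.2 ⟨huv.1, he⟩
      cases hu : f u <;> cases hv : f v <;> simp_all
  have hdeg : (G.monoGraph f).adjPairs Finset.univ Finset.univ =
      2 * ((G.monoGraph f).edgeFinset.card : ℝ) := by
    have := (G.monoGraph f).sum_degrees_eq_twice_card_edges
    rw [adjPairs_eq_sum_card]
    have h2 : (∑ v, ((G.monoGraph f).degree v : ℝ)) =
        2 * ((G.monoGraph f).edgeFinset.card : ℝ) := by exact_mod_cast this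
    rw [← h2]
    refine Finset.sum_congr rfl fun u _ => ?_
    rw [← card_neighborFinset_eq_degree]
    congr 2
    ext w
    simp [mem_nbrsIn]
  rw [hdeg]
  have : (tauB G : ℝ) ≤ (G.monoGraph f).edgeFinset.card := by exact_mod_cast hle
  linarith

end SimpleGraph

open SimpleGraph in
theorem theoremt {V : Type*} [Fintype V] (G : SimpleGraph V) (hG : G.CliqueFree 5) :
    (tauB G : ℝ) ≤ 29 * (Fintype.card V : ℝ) ^ 2 / 200 := by
  classical
  have h : G.CliqueFreeOn ((Finset.univ : Finset V) : Set V) 5 := by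
    rw [Finset.coe_univ]; exact (cliqueFreeOn_univ G).2 hG
  obtain ⟨f, hf⟩ : ∃ f : V → Bool, (G.monoGraph f).adjPairs Finset.univ Finset.univ ≤
      29 / 100 * ((Finset.univ : Finset V).card : ℝ) ^ 2 := by
    rcases le_total (G.adjPairs Finset.univ Finset.univ)
      (63 / 100 * ((Finset.univ : Finset V).card : ℝ) ^ 2) with hE | hE
    · exact exists_coloring_of_cliqueFreeOn_five h hE
    · exact exists_coloring_of_cliqueFreeOn_five_of_dense h hE
  rw [Finset.card_univ] at hf
  have := two_mul_tauB_le G f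
  linarith
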